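/- Consider the plant $\dot x = Ax + Bu$, $y = Cx$ with $x\in\mathbb R^n$, $u\in\mathbb R^m$, $y\in\mathbb R^p$, $p\ge 1$, where $(A,B)$ is controllable, $(C,A)$ is observable and $\operatorname{rank} C = p$. Write $c_1^\top,\dots,c_p^\top$ for the rows of $C$. In the sequence $c_1,\dots,c_p, A^\top c_1,\dots,A^\top c_p,\dots,(A^\top)^n c_1,\dots,(A^\top)^n c_p$, select from left to right each vector that is linearly independent of the vectors before it; let $\nu_i$ be the number of selected vectors of the form $(A^\top)^k c_i$, and let $\nu=\max_i\nu_i$ be the observability index. Assume $\nu_1=\dots=\nu_p=\nu$. Let $(u(t),y(t))$, $t\in[0,\tau]$, $\tau>0$, be the input-output data of one experiment on the plant, with arbitrary initial state $x(0)$ and integrable input $u$. Let $\nu_{\max}>\nu$, $0<\lambda_1<\dots<\lambda_{\nu_{\max}}$, $\gamma_1,\dots,\gamma_{\nu_{\max}}\neq 0$, $N\ge 1$ and $\tau_{\mathrm s}=\tau/N$. For $1\le\hat\nu\le\nu_{\max}$ let $\hat\Lambda=-\operatorname{diag}(\lambda_1,\dots,\lambda_{\hat\nu})$, $\hat\ell=(\gamma_1,\dots,\gamma_{\hat\nu})^\top$,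 let $\chi,\hat\zeta$ solve on $[0,\tau]$ $$\dot\chi=\hat\Lambda\chi,\quad \chi(0)=\hat\ell,\qquad \dot{\hat\zeta}=(I_{p+m}\otimes\hat\Lambda)\hat\zeta+(I_{p+m}\otimes\hat\ell)\begin{bmatrix}y\\u\end{bmatrix},\quad \hat\zeta(0)=0,$$ and let $$\mathcal B_{\hat\nu}=\begin{bmatrix}\chi(0)&\chi(\tau_{\mathrm s})&\cdots&\chi((N-1)\tau_{\mathrm s})\\ \hat\zeta(0)&\hat\zeta(\tau_{\mathrm s})&\cdots&\hat\zeta((N-1)\tau_{\mathrm s})\end{bmatrix}.$$ Then $\operatorname{rank}\mathcal B_{\hat\nu}<\hat\nu(p+m+1)$ for every $\hat\nu$ with $\nu+1\le\hat\nu\le\nu_{\max}$. Consequently the observability index can be estimated from the data: if $\operatorname{rank}\mathcal B_{\nu}=\nu(p+m+1)$, then the procedure that starts from $\hat\nu=1$, increases $\hat\nu$ by one as long as $\hat\nu<\nu_{\max}$ until $\operatorname{rank}\mathcal B_{\hat\nu}<\hat\nu(p+m+1)$ holds for the increased value, and finally decreases $\hat\nu$ by one, returns $\nu$. -/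

import Mathlib

open scoped Matrix Kronecker

/-- `(A, B)` is controllable: the matrix `[B, AB, …, Aⁿ⁻¹B]` has rank `n`. -/
def IsControllablePair {n m : ℕ} (A : Matrix (Fin n) (Fin n) ℝ)
    (B : Matrix (Fin n) (Fin m) ℝ) : Prop :=
  (Matrix.of fun (i : Fin n) (q : Fin n × Fin m) => (A ^ (q.1 : ℕ) * B) i q.2).rank = n

/-- `(C, A)` is observable: the stacked matrix of `C, CA, …, CAⁿ⁻¹` has rank `n`. -/
def IsObservablePair {n p : ℕ} (C : Matrix (Fin p) (Fin n) ℝ)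
    (A : Matrix (Fin n) (Fin n) ℝ) : Prop :=
  (Matrix.of fun (q : Fin n × Fin p) (j : Fin n) => (C * A ^ (q.1 : ℕ)) q.2 j).rank = n

/-- In the sequence `c₁, …, c_p, Aᵀc₁, …, Aᵀc_p, …` (where `cᵢᵀ` is the `i`-th row of `C`), the
vector `(Aᵀ)ᵏ cᵢ` is selected when it is not a linear combination of the vectors to its left. -/
def IsSelectedRow {n p : ℕ} (C : Matrix (Fin p) (Fin n) ℝ) (A : Matrix (Fin n) (Fin n) ℝ)
    (k : ℕ) (i : Fin p) : Prop :=
  (Aᵀ ^ k) *ᵥ C i ∉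
    Submodule.span ℝ {v : Fin n → ℝ | ∃ (l : ℕ) (j : Fin p),
      (l < k ∨ (l = k ∧ j < i)) ∧ v = (Aᵀ ^ l) *ᵥ C j}

open Classical in
/-- The observability index `νᵢ` of the `i`-th output: the number of selected vectors `(Aᵀ)ᵏ cᵢ`,
`k = 0, …, n`. -/
noncomputable def outputObsIndex {n p : ℕ} (C : Matrix (Fin p) (Fin n) ℝ)
    (A : Matrix (Fin n) (Fin n) ℝ) (i : Fin p) : ℕ :=
  ((Finset.range (n + 1)).filter fun k => IsSelectedRow C A k i).card

/-- The observability index `ν = maxᵢ νᵢ`. -/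
noncomputable def obsIndex {n p : ℕ} (C : Matrix (Fin p) (Fin n) ℝ)
    (A : Matrix (Fin n) (Fin n) ℝ) : ℕ :=
  Finset.univ.sup (outputObsIndex C A)

/-- `z` solves `ż(t) = M z(t) + v(t)` on `[0, τ]` in the sense of Carathéodory, with integrable
forcing term `v`: `z` is continuous and satisfies the integral equation (so `z` is absolutely
continuous and the differential equation holds almost everywhere; it holds everywhere if `v` is
continuous). -/
def IsLinearODESolution {ι : Type*} [Fintype ι] (τ : ℝ) (M : Matrix ι ι ℝ)
    (v z : ℝ → ι → ℝ) : Prop :=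
  IntervalIntegrable v MeasureTheory.volume 0 τ ∧
    ContinuousOn z (Set.Icc 0 τ) ∧
    ∀ t ∈ Set.Icc 0 τ, z t = z 0 + ∫ s in (0 : ℝ)..t, (M *ᵥ z s + v s)

/-- `(u(t), y(t))`, `t ∈ [0, τ]`, is the input-output dataset of the experiment with state
trajectory `x` on the plant `ẋ = Ax + Bu`, `y = Cx`, with an integrable input `u`. -/
structure IsPlantDataset {n m p : ℕ} (A : Matrix (Fin n) (Fin n) ℝ)
    (B : Matrix (Fin n) (Fin m) ℝ) (C : Matrix (Fin p) (Fin n) ℝ) (τ : ℝ)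
    (u : ℝ → Fin m → ℝ) (x : ℝ → Fin n → ℝ) (y : ℝ → Fin p → ℝ) : Prop where
  input : IntervalIntegrable u MeasureTheory.volume 0 τ
  state : IsLinearODESolution τ A (fun t => B *ᵥ u t) x
  output : ∀ t ∈ Set.Icc 0 τ, y t = C *ᵥ x t

/-- `Λ̂ = -diag(λ₁, …, λ_k)`. The scalars are numbered from `1`. -/
def filterMatrix (lam : ℕ → ℝ) (k : ℕ) : Matrix (Fin k) (Fin k) ℝ :=
  -Matrix.diagonal fun i : Fin k => lam ((i : ℕ) + 1)

/-- `ℓ̂ = col(γ₁, …, γ_k)`. The scalars are numbered from `1`. -/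
def filterVector (gam : ℕ → ℝ) (k : ℕ) : Fin k → ℝ :=
  fun i => gam ((i : ℕ) + 1)

/-- `I ⊗ ℓ`, where `ℓ` is regarded as a column. -/
def kroneckerColumn (J : Type*) [DecidableEq J] {k : ℕ} (ell : Fin k → ℝ) :
    Matrix (J × Fin k) J ℝ :=
  Matrix.of fun q j => (1 : Matrix J J ℝ) q.1 j * ell q.2

/-- `chi` and `zeta` are the signals on `[0, τ]` simulated with filters of order `k`:
`χ̇ = Λ̂ χ`, `χ(0) = ℓ̂`, and
`ζ̇ = (I_{p+m} ⊗ Λ̂) ζ + (I_{p+m} ⊗ ℓ̂) col(y, u)`, `ζ(0) = 0`. -/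
structure IsFilterSimulation {m p : ℕ} (lam gam : ℕ → ℝ) (τ : ℝ)
    (u : ℝ → Fin m → ℝ) (y : ℝ → Fin p → ℝ) (k : ℕ)
    (chi : ℝ → Fin k → ℝ) (zeta : ℝ → (Fin p ⊕ Fin m) × Fin k → ℝ) : Prop where
  chi_ode : IsLinearODESolution τ (filterMatrix lam k) (fun _ => 0) chi
  chi_init : chi 0 = filterVector gam k
  zeta_ode : IsLinearODESolution τ
    ((1 : Matrix (Fin p ⊕ Fin m) (Fin p ⊕ Fin m) ℝ) ⊗ₖ filterMatrix lam k)
    (fun t => kroneckerColumn (Fin p ⊕ Fin m) (filterVector gam k) *ᵥ Sum.elim (y t) (u t)) zeta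
  zeta_init : zeta 0 = 0

/-- The batch of `N` samples of `col(χ, ζ)` at the instants `0, τₛ, …, (N-1)τₛ`, `τₛ = τ / N`. -/
noncomputable def sampledBatch {ι κ : Type*} (τ : ℝ) (N : ℕ) (chi : ℝ → ι → ℝ)
    (zeta : ℝ → κ → ℝ) : Matrix (ι ⊕ κ) (Fin N) ℝ :=
  Matrix.of fun r j => Sum.elim (chi ((j : ℕ) * (τ / N))) (zeta ((j : ℕ) * (τ / N))) r

open Classical in
/-- The value of the estimate after the loop
`while (index not found and k < kmax) { k ← k + 1; if rankLost k then index found }`,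
entered with the value `k` and the index not found. -/
noncomputable def indexLoop (rankLost : ℕ → Prop) (kmax k : ℕ) : ℕ :=
  if k < kmax then
    if rankLost (k + 1) then k + 1 else indexLoop rankLost kmax (k + 1)
  else k
termination_by kmax - k

/-- The observability index estimate: the loop is entered with the initial guess `1`, and the
final value is decreased by one. -/
noncomputable def indexEstimate (rankLost : ℕ → Prop) (kmax : ℕ) : ℕ :=
  indexLoop rankLost kmax 1 - 1

/-! Let `k > ν` be the filter order. Some nonzero combination of the rows of `χ` and `ζ` vanishes on
all of `[0, τ]`, so every sampled batch loses row rank. An unselected vector gives a relation `∑ d_l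
C A^l = 0` of degree below `k`. Hence `d(s) C = q(s) (A - s I)` with `d(s) = ∑ s^l d_l` and `q` of
degree at most `k - 2` (`vecMul_sum_pow_smul_eq`). At `s = -λ_i`, multiples `β_i` of `d(s)` and
`e_i` of `q(s)` turn the plant equation into a first-order equation for `e_i·x` with rate `-λ_i`,
driven by `β_i·y + e_i B u`. Thus `γ_i e_i·x` is a combination of the signals of the `i`-th filters
(`state_relation`). Lagrange weights give `∑ γ_i e_i = 0`, so the state cancels.

Conversely, full row rank at order `ν` passes to lower orders, whose signals are among those of
order `ν`; the search therefore first fails at `ν + 1`. -/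

/-! ### Polynomial relations between output rows -/

/-- Weights that annihilate all powers of the nodes below the top one. -/
theorem exists_weights_sum_mul_pow_eq_zero {k : ℕ} {s : Fin k → ℝ} (hs : Function.Injective s) :
    ∃ w : Fin k → ℝ, (∀ i, w i ≠ 0) ∧ ∀ a : ℕ, a + 1 < k → ∑ i, w i * s i ^ a = 0 := by
  refine ⟨fun i => (∏ j ∈ Finset.univ.erase i, (s i - s j))⁻¹, fun i => ?_, fun a ha => ?_⟩
  · refine inv_ne_zero (Finset.prod_ne_zero_iff.2 fun j hj => sub_ne_zero.2 fun h => ?_)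
    exact Finset.ne_of_mem_erase hj (hs h).symm
  · have hdeg : (Polynomial.X ^ a : Polynomial ℝ).degree < (Finset.univ : Finset (Fin k)).card := by
      rw [Polynomial.degree_X_pow, Finset.card_univ, Fintype.card_fin]
      exact_mod_cast (by omega : a < k)
    -- With these weights, `∑ w_i f(s_i)` is the coefficient of degree `k - 1` of `f`, which is zero
    -- for lower powers.
    have h := Lagrange.coeff_eq_sum (s := Finset.univ) (v := s) hs.injOn hdeg
    rw [Finset.card_univ, Fintype.card_fin, Polynomial.coeff_X_pow, if_neg (by omega)] at h
    simp only [Polynomial.eval_pow, Polynomial.eval_X] at h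
    rw [h]
    exact Finset.sum_congr rfl fun i _ => by rw [div_eq_mul_inv, mul_comm]

/-- By Cayley–Hamilton, no vector `(Aᵀ)ⁿ cᵢ` is selected. -/
theorem not_isSelectedRow_dim {n p : ℕ} (C : Matrix (Fin p) (Fin n) ℝ)
    (A : Matrix (Fin n) (Fin n) ℝ) (i : Fin p) : ¬ IsSelectedRow C A n i := by
  intro h
  apply h
  have hch := Matrix.aeval_self_charpoly Aᵀ
  have hdeg : Aᵀ.charpoly.natDegree = n := by
    simp [Matrix.charpoly_natDegree_eq_dim]
  have hmon : Aᵀ.charpoly.coeff n = 1 := by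
    have := (Matrix.charpoly_monic Aᵀ).coeff_natDegree
    rwa [hdeg] at this
  rw [Polynomial.aeval_eq_sum_range, hdeg, Finset.sum_range_succ, hmon, one_smul] at hch
  rw [eq_neg_of_add_eq_zero_right hch, Matrix.neg_mulVec, Matrix.sum_mulVec]
  refine Submodule.neg_mem _ (Submodule.sum_mem _ fun l hl => ?_)
  rw [Matrix.smul_mulVec]
  exact Submodule.smul_mem _ _
    (Submodule.subset_span ⟨l, i, Or.inl (Finset.mem_range.1 hl), rfl⟩)

/-- Pigeonhole: otherwise the `νᵢ + 1` exponents `0, …, νᵢ` would all be counted by `νᵢ`. -/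
theorem exists_not_isSelectedRow_le {n p : ℕ} (C : Matrix (Fin p) (Fin n) ℝ)
    (A : Matrix (Fin n) (Fin n) ℝ) (i : Fin p) :
    ∃ K ≤ outputObsIndex C A i, ¬ IsSelectedRow C A K i := by
  classical
  by_contra! hsel
  have hn : outputObsIndex C A i < n := by
    by_contra! hn
    exact not_isSelectedRow_dim C A i (hsel n hn)
  have hsub : Finset.range (outputObsIndex C A i + 1) ⊆
      (Finset.range (n + 1)).filter fun k => IsSelectedRow C A k i := by
    intro k hk
    rw [Finset.mem_range] at hk
    exact Finset.mem_filter.2 ⟨Finset.mem_range.2 (by omega), hsel k (by omega)⟩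
  have hcard := Finset.card_le_card hsub
  rw [Finset.card_range] at hcard
  have hdef : outputObsIndex C A i =
      ((Finset.range (n + 1)).filter fun k => IsSelectedRow C A k i).card := by
    unfold outputObsIndex
    congr
  omega

theorem exists_coeff_of_not_isSelectedRow {n p : ℕ} {C : Matrix (Fin p) (Fin n) ℝ}
    {A : Matrix (Fin n) (Fin n) ℝ} {K : ℕ} {i : Fin p} (h : ¬ IsSelectedRow C A K i)
    {k : ℕ} (hK : K < k) :
    ∃ d : Fin k → Fin p → ℝ, d ≠ 0 ∧ ∑ l, d l ᵥ* (C * A ^ (l : ℕ)) = 0 := by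
  classical
  -- Coefficient zero at `(K, i)` ensures that subtracting `d` from the unit coefficient there
  -- leaves a nonzero relation.
  have key : ∀ v ∈ Submodule.span ℝ {v : Fin n → ℝ | ∃ (l : ℕ) (j : Fin p),
      (l < K ∨ (l = K ∧ j < i)) ∧ v = (Aᵀ ^ l) *ᵥ C j},
      ∃ d : Fin k → Fin p → ℝ, d ⟨K, hK⟩ i = 0 ∧ ∑ l, d l ᵥ* (C * A ^ (l : ℕ)) = v := by
    intro v hv
    induction hv using Submodule.span_induction with
    | mem v hv =>
      obtain ⟨l, j, hlj, rfl⟩ := hv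
      have hl : l < k := by omega
      refine ⟨Pi.single ⟨l, hl⟩ (Pi.single j 1), ?_, ?_⟩
      · rcases hlj with hlK | ⟨rfl, hji⟩
        · rw [Pi.single_eq_of_ne (by simp [Fin.ext_iff]; omega)]; rfl
        · rw [Pi.single_eq_same, Pi.single_eq_of_ne hji.ne']
      · rw [Finset.sum_eq_single ⟨l, hl⟩ (fun b _ hb => by
          rw [Pi.single_eq_of_ne hb, Matrix.zero_vecMul]) (by simp), Pi.single_eq_same,
          ← Matrix.vecMul_vecMul, Matrix.single_one_vecMul, ← Matrix.transpose_pow,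
          Matrix.mulVec_transpose]
        rfl
    | zero => exact ⟨0, rfl, by simp⟩
    | add v v' _ _ hv hv' =>
      obtain ⟨d, hd, rfl⟩ := hv
      obtain ⟨d', hd', rfl⟩ := hv'
      exact ⟨d + d', by simp [hd, hd'], by simp [Matrix.add_vecMul, Finset.sum_add_distrib]⟩
    | smul a v _ hv =>
      obtain ⟨d, hd, rfl⟩ := hv
      exact ⟨a • d, by simp [hd], by simp [Matrix.smul_vecMul, Finset.smul_sum]⟩
  obtain ⟨d, hd, hsum⟩ := key _ (not_not.1 h)
  refine ⟨Pi.single ⟨K, hK⟩ (Pi.single i 1) - d, fun h0 => ?_, ?_⟩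
  · have := congrFun (congrFun h0 ⟨K, hK⟩) i
    simp [hd] at this
  · simp only [Pi.sub_apply, Matrix.sub_vecMul, Finset.sum_sub_distrib, hsum]
    rw [Finset.sum_eq_single ⟨K, hK⟩ (fun b _ hb => by
          rw [Pi.single_eq_of_ne hb, Matrix.zero_vecMul]) (by simp), Pi.single_eq_same,
          ← Matrix.vecMul_vecMul, Matrix.single_one_vecMul, ← Matrix.transpose_pow,
          Matrix.mulVec_transpose]
    exact sub_self _

/-- `s I - A` divides `s^l I - A^l`, and the terms in `A^l` cancel by `hd`. -/
theorem vecMul_sum_pow_smul_eq {n p k : ℕ} {C : Matrix (Fin p) (Fin n) ℝ}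
    {A : Matrix (Fin n) (Fin n) ℝ} {d : Fin k → Fin p → ℝ}
    (hd : ∑ l, d l ᵥ* (C * A ^ (l : ℕ)) = 0) (s : ℝ) :
    (∑ l : Fin k, s ^ (l : ℕ) • d l) ᵥ* C =
      (-∑ l : Fin k, ∑ a ∈ Finset.range (l : ℕ), s ^ a • (d l ᵥ* (C * A ^ ((l : ℕ) - 1 - a)))) ᵥ*
        (A - s • (1 : Matrix (Fin n) (Fin n) ℝ)) := by
  have hgeom : ∀ l : ℕ, ∑ a ∈ Finset.range l,
      s ^ a • (A ^ (l - 1 - a) * (s • (1 : Matrix (Fin n) (Fin n) ℝ) - A)) =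
        s ^ l • (1 : Matrix (Fin n) (Fin n) ℝ) - A ^ l := by
    intro l
    have hc : Commute (s • (1 : Matrix (Fin n) (Fin n) ℝ)) A :=
      (Commute.one_left A).smul_left s
    have := hc.geom_sum₂_mul l
    simp only [smul_pow, one_pow, Finset.sum_mul, smul_mul_assoc, one_mul] at this
    simpa only [smul_mul_assoc] using this
  have hrow : ∀ l : Fin k, (∑ a ∈ Finset.range (l : ℕ),
      s ^ a • (d l ᵥ* (C * A ^ ((l : ℕ) - 1 - a)))) ᵥ*
        (s • (1 : Matrix (Fin n) (Fin n) ℝ) - A) =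
      (s ^ (l : ℕ) • d l) ᵥ* C - d l ᵥ* (C * A ^ (l : ℕ)) := by
    intro l
    rw [Matrix.sum_vecMul]
    simp only [Matrix.smul_vecMul, Matrix.vecMul_vecMul, Matrix.mul_assoc]
    have := congrArg (fun M => d l ᵥ* (C * M)) (hgeom l)
    simp only [Matrix.mul_sum, Matrix.vecMul_sum, Matrix.mul_smul, Matrix.vecMul_smul,
      Matrix.mul_sub, Matrix.vecMul_sub, Matrix.mul_one] at this ⊢
    exact this
  rw [← neg_sub (s • (1 : Matrix (Fin n) (Fin n) ℝ)) A, Matrix.neg_vecMul_neg, Matrix.sum_vecMul,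
    Matrix.sum_vecMul]
  simp only [hrow, Finset.sum_sub_distrib, hd, sub_zero]

/-- From a polynomial relation of degree below `k` between the output rows, coefficients that relate
the outputs of `k` first-order filters. -/
theorem exists_filter_coefficients {n p k : ℕ} {C : Matrix (Fin p) (Fin n) ℝ}
    {A : Matrix (Fin n) (Fin n) ℝ} {d : Fin k → Fin p → ℝ} (hd0 : d ≠ 0)
    (hd : ∑ l, d l ᵥ* (C * A ^ (l : ℕ)) = 0) {r g : Fin k → ℝ} (hr : Function.Injective r)
    (hg : ∀ i, g i ≠ 0) :
    ∃ (β : Fin k → Fin p → ℝ) (e : Fin k → Fin n → ℝ), β ≠ 0 ∧ ∑ i, g i • e i = 0 ∧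
      ∀ i, β i ᵥ* C = e i ᵥ* A + r i • e i := by
  have hs : Function.Injective fun i => -r i := neg_injective.comp hr
  obtain ⟨w, hw0, hw⟩ := exists_weights_sum_mul_pow_eq_zero hs
  -- Both sides of the identity are taken at `s = -r i`; dividing by `g i` makes the sum of `g i • e
  -- i` carry the bare weights `w i`.
  refine ⟨fun i => (w i / g i) • ∑ l : Fin k, (-r i) ^ (l : ℕ) • d l,
    fun i => (w i / g i) • -∑ l : Fin k, ∑ a ∈ Finset.range (l : ℕ),
      (-r i) ^ a • (d l ᵥ* (C * A ^ ((l : ℕ) - 1 - a))), fun h0 => hd0 ?_, ?_, fun i => ?_⟩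
  · ext l j
    -- Vandermonde: a polynomial of degree below `k` with `k` distinct zeros is zero.
    have hz : (fun l => d l j) = 0 := by
      refine Matrix.eq_zero_of_forall_index_sum_pow_mul_eq_zero hs fun i => ?_
      have hi := congrFun h0 i
      simp only [Pi.zero_apply, smul_eq_zero, div_eq_zero_iff, hw0 i, hg i, or_self,
        false_or] at hi
      simpa [Finset.sum_apply] using congrFun hi j
    exact congrFun hz l
  · simp only [smul_smul, smul_neg, Finset.sum_neg_distrib,
      Finset.smul_sum, neg_eq_zero]
    rw [Finset.sum_comm]
    refine Finset.sum_eq_zero fun l _ => ?_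
    rw [Finset.sum_comm]
    refine Finset.sum_eq_zero fun a ha => ?_
    rw [← Finset.sum_smul, ← zero_smul ℝ (d l ᵥ* (C * A ^ ((l : ℕ) - 1 - a)))]
    congr 1
    have hal : a + 1 < k := by have := Finset.mem_range.1 ha; omega
    rw [← hw a hal]
    exact Finset.sum_congr rfl fun i _ => by rw [← mul_assoc, mul_div_cancel₀ _ (hg i)]
  · dsimp only
    rw [Matrix.smul_vecMul, vecMul_sum_pow_smul_eq hd, ← Matrix.smul_vecMul, Matrix.vecMul_sub,
      Matrix.vecMul_smul, Matrix.vecMul_one, neg_smul, sub_neg_eq_add]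

theorem one_le_obsIndex {n p : ℕ} (hp : 0 < p) {C : Matrix (Fin p) (Fin n) ℝ}
    (hC : C.rank = p) (A : Matrix (Fin n) (Fin n) ℝ) : 1 ≤ obsIndex C A := by
  classical
  let i₀ : Fin p := ⟨0, hp⟩
  have hli : LinearIndependent ℝ C.row := by
    rw [linearIndependent_iff_card_eq_finrank_span, Set.finrank, ← Matrix.rank_eq_finrank_span_row,
      hC, Fintype.card_fin]
  have hsel : IsSelectedRow C A 0 i₀ := by
    intro hmem
    have hempty : {v : Fin n → ℝ | ∃ (l : ℕ) (j : Fin p),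
        (l < 0 ∨ (l = 0 ∧ j < i₀)) ∧ v = (Aᵀ ^ l) *ᵥ C j} = ∅ := by
      refine Set.eq_empty_of_forall_notMem ?_
      rintro v ⟨l, j, h | ⟨-, h⟩, -⟩
      · omega
      · exact absurd (Fin.lt_def.1 h) (by simp [i₀])
    rw [hempty, Submodule.span_empty, Submodule.mem_bot, pow_zero, Matrix.one_mulVec] at hmem
    exact hli.ne_zero i₀ hmem
  refine le_trans ?_ (Finset.le_sup (f := outputObsIndex C A) (Finset.mem_univ i₀))
  unfold outputObsIndex
  exact Finset.card_pos.2 ⟨0, Finset.mem_filter.2 ⟨by simp, hsel⟩⟩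

/-! ### Scalar Carathéodory equations -/

/-- `f` is continuous on `[0, τ]` and is there the integral of the integrable function `g`. -/
structure IsPrimitiveOn (τ : ℝ) (f g : ℝ → ℝ) : Prop where
  integrable : IntervalIntegrable g MeasureTheory.volume 0 τ
  continuousOn : ContinuousOn f (Set.Icc 0 τ)
  eq_integral : ∀ t ∈ Set.Icc 0 τ, f t = f 0 + ∫ s in (0 : ℝ)..t, g s

namespace IsPrimitiveOn

variable {τ : ℝ} {f g f' g' : ℝ → ℝ}

theorem integrable_of_mem (h : IsPrimitiveOn τ f g) {t : ℝ} (ht : t ∈ Set.Icc 0 τ) :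
    IntervalIntegrable g MeasureTheory.volume 0 t :=
  h.integrable.mono_set (by
    rw [Set.uIcc_of_le ht.1, Set.uIcc_of_le (ht.1.trans ht.2)]
    exact Set.Icc_subset_Icc le_rfl ht.2)

theorem zero : IsPrimitiveOn τ (fun _ => 0) (fun _ => 0) :=
  ⟨by simp, continuousOn_const, by simp⟩

theorem add (h : IsPrimitiveOn τ f g) (h' : IsPrimitiveOn τ f' g') :
    IsPrimitiveOn τ (fun t => f t + f' t) (fun t => g t + g' t) :=
  ⟨h.integrable.add h'.integrable, h.continuousOn.add h'.continuousOn, fun t ht => by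
    rw [intervalIntegral.integral_add (h.integrable_of_mem ht) (h'.integrable_of_mem ht),
      h.eq_integral t ht, h'.eq_integral t ht]
    ring⟩

theorem const_mul (h : IsPrimitiveOn τ f g) (c : ℝ) :
    IsPrimitiveOn τ (fun t => c * f t) (fun t => c * g t) :=
  ⟨h.integrable.const_mul c, continuousOn_const.mul h.continuousOn, fun t ht => by
    rw [intervalIntegral.integral_const_mul, h.eq_integral t ht]
    ring⟩

theorem sub (h : IsPrimitiveOn τ f g) (h' : IsPrimitiveOn τ f' g') :
    IsPrimitiveOn τ (fun t => f t - f' t) (fun t => g t - g' t) := by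
  simpa [sub_eq_add_neg] using h.add (h'.const_mul (-1))

theorem sum {ι : Type*} (s : Finset ι) {F G : ι → ℝ → ℝ}
    (h : ∀ i ∈ s, IsPrimitiveOn τ (F i) (G i)) :
    IsPrimitiveOn τ (fun t => ∑ i ∈ s, F i t) (fun t => ∑ i ∈ s, G i t) := by
  classical
  induction s using Finset.induction_on with
  | empty => simpa using zero
  | insert a s ha ih =>
    simp only [Finset.sum_insert ha]
    exact (h a (Finset.mem_insert_self a s)).add
      (ih fun i hi => h i (Finset.mem_insert_of_mem hi))

theorem congr (hτ : 0 ≤ τ) (h : IsPrimitiveOn τ f g) (hg : ∀ t ∈ Set.Icc 0 τ, g t = g' t) :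
    IsPrimitiveOn τ f g' := by
  refine ⟨h.integrable.congr fun t ht => hg t ?_, h.continuousOn, fun t ht => ?_⟩
  · rw [Set.uIoc_of_le hτ] at ht
    exact Set.Ioc_subset_Icc_self ht
  · rw [h.eq_integral t ht]
    congr 1
    refine intervalIntegral.integral_congr fun s hs => hg s ?_
    rw [Set.uIcc_of_le ht.1] at hs
    exact ⟨hs.1, hs.2.trans ht.2⟩

/-- Uniqueness for the scalar equation `ḟ = r f`, `f(0) = 0`. -/
theorem eq_zero_of_rate (hτ : 0 ≤ τ) {r : ℝ} (h : IsPrimitiveOn τ f fun t => r * f t)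
    (h0 : f 0 = 0) : ∀ t ∈ Set.Icc 0 τ, f t = 0 := by
  have hderiv : ∀ t ∈ Set.Ico 0 τ, HasDerivWithinAt f (r * f t) (Set.Ici t) t := by
    intro t ht
    have htI : t ∈ Set.Icc 0 τ := Set.Ico_subset_Icc_self ht
    -- A continuous extension to the line makes the integral differentiable also at the endpoint
    -- `0`.
    let F : ℝ → ℝ := Set.IccExtend hτ (Set.domRestrict (Set.Icc 0 τ) f)
    have hF : Continuous F := (continuousOn_iff_continuous_domRestrict.1 h.continuousOn).Icc_extend'
    have hFf : ∀ s ∈ Set.Icc 0 τ, F s = f s := fun s hs => Set.IccExtend_of_mem hτ _ hs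
    have hd : HasDerivAt (fun t => ∫ s in (0 : ℝ)..t, r * F s) (r * F t) t :=
      intervalIntegral.integral_hasDerivAt_right ((continuous_const.mul hF).intervalIntegrable _ _)
        (continuous_const.mul hF).stronglyMeasurable.stronglyMeasurableAtFilter
        (continuous_const.mul hF).continuousAt
    have heq : ∀ s ∈ Set.Icc 0 τ, f s = ∫ a in (0 : ℝ)..s, r * F a := by
      intro s hs
      rw [h.eq_integral s hs, h0, zero_add]
      refine intervalIntegral.integral_congr fun a ha => ?_
      rw [Set.uIcc_of_le hs.1] at ha
      simp only [hFf a ⟨ha.1, ha.2.trans hs.2⟩]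
    rw [hFf t htI] at hd
    refine hd.hasDerivWithinAt.congr_of_eventuallyEq ?_ (heq t htI)
    filter_upwards [Icc_mem_nhdsGE ht.2] with s hs
    exact heq s ⟨ht.1.trans hs.1, hs.2⟩
  intro t ht
  have := norm_le_gronwallBound_of_norm_deriv_right_le (δ := 0) (K := |r|) (ε := 0)
    h.continuousOn hderiv (by simp [h0]) (fun s _ => by simp) t ht
  simpa [gronwallBound_ε0_δ0] using this

end IsPrimitiveOn

theorem IsLinearODESolution.isPrimitiveOn {ι : Type*} [Fintype ι] {τ : ℝ} (hτ : 0 ≤ τ)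
    {M : Matrix ι ι ℝ} {v z : ℝ → ι → ℝ} (h : IsLinearODESolution τ M v z) (q : ι) :
    IsPrimitiveOn τ (fun t => z t q) (fun t => (M *ᵥ z t) q + v t q) := by
  obtain ⟨hv, hz, heq⟩ := h
  have hM : ContinuousOn (fun t => M *ᵥ z t) (Set.uIcc 0 τ) := by
    rw [Set.uIcc_of_le hτ]
    exact (Continuous.matrix_mulVec continuous_const continuous_id).comp_continuousOn hz
  have hint : IntervalIntegrable (fun t => M *ᵥ z t + v t) MeasureTheory.volume 0 τ :=
    hM.intervalIntegrable.add hv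
  let π : (ι → ℝ) →L[ℝ] ℝ := ContinuousLinearMap.proj q
  refine ⟨?_, (continuous_apply q).comp_continuousOn hz, fun t ht => ?_⟩
  · exact ⟨π.integrable_comp hint.1, π.integrable_comp hint.2⟩
  · have hint' : IntervalIntegrable (fun t => M *ᵥ z t + v t) MeasureTheory.volume 0 t :=
      hint.mono_set (by
        rw [Set.uIcc_of_le ht.1, Set.uIcc_of_le hτ]
        exact Set.Icc_subset_Icc le_rfl ht.2)
    have hc := π.intervalIntegral_comp_comm hint'
    have := congrFun (heq t ht) q
    rw [Pi.add_apply] at this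
    rw [this]
    congr 1
    exact hc.symm

/-! ### Filter signals and their annihilator -/

section

variable {m p k : ℕ} {lam gam : ℕ → ℝ} {τ : ℝ} {u : ℝ → Fin m → ℝ} {y : ℝ → Fin p → ℝ}
  {chi : ℝ → Fin k → ℝ} {zeta : ℝ → (Fin p ⊕ Fin m) × Fin k → ℝ}

theorem IsFilterSimulation.isPrimitiveOn_chi (hτ : 0 ≤ τ)
    (h : IsFilterSimulation lam gam τ u y k chi zeta) (i : Fin k) :
    IsPrimitiveOn τ (fun t => chi t i) (fun t => -lam (i + 1) * chi t i) := by
  have := h.chi_ode.isPrimitiveOn hτ i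
  simpa [filterMatrix, Matrix.neg_mulVec, Matrix.mulVec_diagonal] using this

theorem IsFilterSimulation.isPrimitiveOn_zeta (hτ : 0 ≤ τ)
    (h : IsFilterSimulation lam gam τ u y k chi zeta) (j : Fin p ⊕ Fin m) (i : Fin k) :
    IsPrimitiveOn τ (fun t => zeta t (j, i))
      (fun t => -lam (i + 1) * zeta t (j, i) + gam (i + 1) * Sum.elim (y t) (u t) j) := by
  have hpos := h.zeta_ode.isPrimitiveOn hτ (j, i)
  have h1 : ∀ t, ((1 : Matrix (Fin p ⊕ Fin m) (Fin p ⊕ Fin m) ℝ) ⊗ₖ filterMatrix lam k *ᵥ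
      zeta t) (j, i) = -lam (i + 1) * zeta t (j, i) := by
    intro t
    rw [filterMatrix, Matrix.diagonal_neg, ← Matrix.diagonal_one,
      Matrix.diagonal_kronecker_diagonal, Matrix.mulVec_diagonal]
    simp
  have h2 : ∀ t, (kroneckerColumn (Fin p ⊕ Fin m) (filterVector gam k) *ᵥ
      Sum.elim (y t) (u t)) (j, i) = gam (i + 1) * Sum.elim (y t) (u t) j := by
    intro t
    simp only [Matrix.mulVec, dotProduct, kroneckerColumn, Matrix.of_apply, filterVector]
    rw [Finset.sum_eq_single j (fun b _ hb => by simp [Matrix.one_apply_ne hb.symm]) (by simp)]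
    simp
  simpa only [h1, h2] using hpos

end

theorem Matrix.linearIndependent_row_iff_rank_eq {ι κ : Type*} [Fintype ι] [Fintype κ]
    (M : Matrix ι κ ℝ) : LinearIndependent ℝ M.row ↔ M.rank = Fintype.card ι := by
  rw [linearIndependent_iff_card_eq_finrank_span, Set.finrank, ← Matrix.rank_eq_finrank_span_row,
    eq_comm]

/-- The signals of the `i`-th first-order filters determine the filtered plant equation. -/
theorem IsFilterSimulation.state_relation {n m p k : ℕ} {A : Matrix (Fin n) (Fin n) ℝ}
    {B : Matrix (Fin n) (Fin m) ℝ} {C : Matrix (Fin p) (Fin n) ℝ} {τ : ℝ} (hτ : 0 ≤ τ)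
    {u : ℝ → Fin m → ℝ} {x : ℝ → Fin n → ℝ} {y : ℝ → Fin p → ℝ}
    (hdata : IsPlantDataset A B C τ u x y) {lam gam : ℕ → ℝ}
    {chi : ℝ → Fin k → ℝ} {zeta : ℝ → (Fin p ⊕ Fin m) × Fin k → ℝ}
    (h : IsFilterSimulation lam gam τ u y k chi zeta) (i : Fin k)
    {β : Fin p → ℝ} {e : Fin n → ℝ} (hβ : β ᵥ* C = e ᵥ* A + lam (i + 1) • e) :
    ∀ t ∈ Set.Icc 0 τ, (e ⬝ᵥ x 0) * chi t i + ∑ j, Sum.elim β (e ᵥ* B) j * zeta t (j, i) =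
      gam (i + 1) * (e ⬝ᵥ x t) := by
  have hchi := (h.isPrimitiveOn_chi hτ i).const_mul (e ⬝ᵥ x 0)
  have hzeta := IsPrimitiveOn.sum Finset.univ fun j _ =>
    (h.isPrimitiveOn_zeta hτ j i).const_mul (Sum.elim β (e ᵥ* B) j)
  have hx := (IsPrimitiveOn.sum Finset.univ fun q _ =>
    (hdata.state.isPrimitiveOn hτ q).const_mul (e q)).const_mul (gam (i + 1))
  -- The difference of the two sides solves the homogeneous equation with rate `-λ_i`; it vanishes
  -- at `0` because `χ_i(0) = γ_i` and `ζ(0) = 0`.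
  have hg := ((hchi.add hzeta).sub hx).congr hτ (g' := fun t => -lam (i + 1) *
      ((e ⬝ᵥ x 0) * chi t i + ∑ j, Sum.elim β (e ᵥ* B) j * zeta t (j, i) -
        gam (i + 1) * ∑ q, e q * x t q)) fun t ht => by
    have hsum : ∑ j, Sum.elim β (e ᵥ* B) j * (-lam (i + 1) * zeta t (j, i) +
          gam (i + 1) * Sum.elim (y t) (u t) j) =
        -lam (i + 1) * ∑ j, Sum.elim β (e ᵥ* B) j * zeta t (j, i) +
          gam (i + 1) * (β ⬝ᵥ y t + (e ᵥ* B) ⬝ᵥ u t) := by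
      have hyu : β ⬝ᵥ y t + (e ᵥ* B) ⬝ᵥ u t =
          ∑ j, Sum.elim β (e ᵥ* B) j * Sum.elim (y t) (u t) j := by
        simp [dotProduct]
      rw [hyu, Finset.mul_sum, Finset.mul_sum, ← Finset.sum_add_distrib]
      exact Finset.sum_congr rfl fun j _ => by ring
    have hstate : ∑ q, e q * ((A *ᵥ x t) q + (B *ᵥ u t) q) =
        (e ᵥ* A) ⬝ᵥ x t + (e ᵥ* B) ⬝ᵥ u t := by
      rw [← Matrix.dotProduct_mulVec, ← Matrix.dotProduct_mulVec, ← dotProduct_add]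
      rfl
    have hout : β ⬝ᵥ y t = (e ᵥ* A) ⬝ᵥ x t + lam (i + 1) * ∑ q, e q * x t q := by
      rw [hdata.output t ht, Matrix.dotProduct_mulVec, hβ, add_dotProduct, smul_dotProduct]
      rfl
    rw [hsum, hstate, hout]
    ring
  have h0 := hg.eq_zero_of_rate hτ (by
    simp only [h.chi_init, h.zeta_init, filterVector, dotProduct, Pi.zero_apply, mul_zero,
      Finset.sum_const_zero, add_zero]
    ring)
  exact fun t ht => sub_eq_zero.1 (h0 t ht)

theorem IsFilterSimulation.exists_annihilator {n m p k : ℕ} {A : Matrix (Fin n) (Fin n) ℝ}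
    {B : Matrix (Fin n) (Fin m) ℝ} {C : Matrix (Fin p) (Fin n) ℝ} {τ : ℝ} (hτ : 0 ≤ τ)
    {u : ℝ → Fin m → ℝ} {x : ℝ → Fin n → ℝ} {y : ℝ → Fin p → ℝ}
    (hdata : IsPlantDataset A B C τ u x y) {lam gam : ℕ → ℝ}
    {chi : ℝ → Fin k → ℝ} {zeta : ℝ → (Fin p ⊕ Fin m) × Fin k → ℝ}
    (h : IsFilterSimulation lam gam τ u y k chi zeta)
    (hlam : Set.InjOn lam (Set.Icc 1 k)) (hgam : ∀ i ∈ Set.Icc 1 k, gam i ≠ 0)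
    (hp : 0 < p) (hk : obsIndex C A < k) :
    ∃ w : Fin k ⊕ (Fin p ⊕ Fin m) × Fin k → ℝ, w ≠ 0 ∧
      ∀ t ∈ Set.Icc 0 τ, w ⬝ᵥ Sum.elim (chi t) (zeta t) = 0 := by
  have hmem : ∀ i : Fin k, (i : ℕ) + 1 ∈ Set.Icc 1 k := fun i => ⟨by omega, i.2⟩
  obtain ⟨K, hK, hsel⟩ := exists_not_isSelectedRow_le C A ⟨0, hp⟩
  have hKk : K < k :=
    (hK.trans (Finset.le_sup (f := outputObsIndex C A) (Finset.mem_univ _))).trans_lt hk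
  obtain ⟨d, hd0, hd⟩ := exists_coeff_of_not_isSelectedRow hsel hKk
  obtain ⟨β, e, hβ0, he, hβ⟩ := exists_filter_coefficients hd0 hd
    (r := fun i : Fin k => lam (i + 1)) (g := fun i : Fin k => gam (i + 1))
    (fun i j hij => Fin.ext (Nat.succ_injective (hlam (hmem i) (hmem j) hij)))
    (fun i => hgam _ (hmem i))
  -- The `χ` block absorbs the unknown initial state; the `y` block is `β`, which makes the vector
  -- nonzero.
  refine ⟨Sum.elim (fun i => e i ⬝ᵥ x 0) fun q => Sum.elim (β q.2) (e q.2 ᵥ* B) q.1,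
    fun h0 => hβ0 ?_, fun t ht => ?_⟩
  · ext i j
    exact congrFun h0 (Sum.inr (Sum.inl j, i))
  · have hrel := fun i => h.state_relation hτ hdata i (hβ i) t ht
    rw [sumElim_dotProduct_sumElim]
    simp only [dotProduct, Fintype.sum_prod_type_right]
    rw [← Finset.sum_add_distrib]
    have hzero : (∑ i, gam ((i : Fin k) + 1) • e i) ⬝ᵥ x t = 0 := by
      rw [he, zero_dotProduct]
    rw [sum_dotProduct] at hzero
    refine Eq.trans ?_ hzero
    exact Finset.sum_congr rfl fun i _ => by
      rw [smul_dotProduct, smul_eq_mul, ← hrel i]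
      rfl

/-! ### Rank of the sampled batch -/

theorem sample_mem_Icc {τ : ℝ} (hτ : 0 ≤ τ) {N : ℕ} (j : Fin N) :
    (j : ℕ) * (τ / N) ∈ Set.Icc 0 τ := by
  have hN : (0 : ℝ) < N := by exact_mod_cast j.pos
  refine ⟨by positivity, ?_⟩
  rw [← mul_div_assoc, div_le_iff₀ hN, mul_comm]
  exact mul_le_mul_of_nonneg_left (by exact_mod_cast j.2.le) hτ

theorem card_batch_rows (m p k : ℕ) :
    Fintype.card (Fin k ⊕ (Fin p ⊕ Fin m) × Fin k) = k * (p + m + 1) := by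
  simp only [Fintype.card_sum, Fintype.card_prod, Fintype.card_fin]
  ring

theorem rank_sampledBatch_lt_of_annihilator {m p k N : ℕ} {τ : ℝ} (hτ : 0 ≤ τ)
    {chi : ℝ → Fin k → ℝ} {zeta : ℝ → (Fin p ⊕ Fin m) × Fin k → ℝ}
    {w : Fin k ⊕ (Fin p ⊕ Fin m) × Fin k → ℝ} (hw : w ≠ 0)
    (h : ∀ t ∈ Set.Icc 0 τ, w ⬝ᵥ Sum.elim (chi t) (zeta t) = 0) :
    (sampledBatch τ N chi zeta).rank < k * (p + m + 1) := by
  rw [← card_batch_rows]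
  refine lt_of_le_of_ne (Matrix.rank_le_card_height _) fun hr => hw ?_
  have hli := (Matrix.linearIndependent_row_iff_rank_eq _).2 hr
  ext r
  refine Fintype.linearIndependent_iff.1 hli w ?_ r
  ext j
  rw [Finset.sum_apply]
  exact h _ (sample_mem_Icc hτ j)

/-- Filters of lower order produce some of the signals of the filters of higher order. -/
theorem IsFilterSimulation.eq_castLE {m p k l : ℕ} (hkl : k ≤ l) {τ : ℝ} (hτ : 0 ≤ τ)
    {u : ℝ → Fin m → ℝ} {y : ℝ → Fin p → ℝ} {lam gam : ℕ → ℝ}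
    {chi : ℝ → Fin k → ℝ} {zeta : ℝ → (Fin p ⊕ Fin m) × Fin k → ℝ}
    {chi' : ℝ → Fin l → ℝ} {zeta' : ℝ → (Fin p ⊕ Fin m) × Fin l → ℝ}
    (h : IsFilterSimulation lam gam τ u y k chi zeta)
    (h' : IsFilterSimulation lam gam τ u y l chi' zeta') {t : ℝ} (ht : t ∈ Set.Icc 0 τ) :
    Sum.elim (chi t) (zeta t) =
      Sum.elim (chi' t) (zeta' t) ∘ Sum.map (Fin.castLE hkl) (Prod.map id (Fin.castLE hkl)) := by
  funext r
  rcases r with i | ⟨j, i⟩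
  · have hd := ((h.isPrimitiveOn_chi hτ i).sub (h'.isPrimitiveOn_chi hτ (Fin.castLE hkl i))).congr
      hτ (g' := fun t => -lam (i + 1) * (chi t i - chi' t (Fin.castLE hkl i)))
      fun t _ => by rw [Fin.val_castLE]; ring
    refine sub_eq_zero.1 (hd.eq_zero_of_rate hτ ?_ t ht)
    simp [h.chi_init, h'.chi_init, filterVector]
  · have hd := ((h.isPrimitiveOn_zeta hτ j i).sub
      (h'.isPrimitiveOn_zeta hτ j (Fin.castLE hkl i))).congr
      hτ (g' := fun t => -lam (i + 1) * (zeta t (j, i) - zeta' t (j, Fin.castLE hkl i)))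
      fun t _ => by rw [Fin.val_castLE]; ring
    refine sub_eq_zero.1 (hd.eq_zero_of_rate hτ ?_ t ht)
    simp [h.zeta_init, h'.zeta_init]

/-- The smaller batch consists of distinct rows of the larger one, which are linearly independent.
-/
theorem IsFilterSimulation.rank_sampledBatch_eq_of_le {m p k l N : ℕ} (hkl : k ≤ l) {τ : ℝ}
    (hτ : 0 ≤ τ) {u : ℝ → Fin m → ℝ} {y : ℝ → Fin p → ℝ} {lam gam : ℕ → ℝ}
    {chi : ℝ → Fin k → ℝ} {zeta : ℝ → (Fin p ⊕ Fin m) × Fin k → ℝ}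
    {chi' : ℝ → Fin l → ℝ} {zeta' : ℝ → (Fin p ⊕ Fin m) × Fin l → ℝ}
    (h : IsFilterSimulation lam gam τ u y k chi zeta)
    (h' : IsFilterSimulation lam gam τ u y l chi' zeta')
    (hr : (sampledBatch τ N chi' zeta').rank = l * (p + m + 1)) :
    (sampledBatch τ N chi zeta).rank = k * (p + m + 1) := by
  rw [← card_batch_rows, ← Matrix.linearIndependent_row_iff_rank_eq] at hr ⊢
  have hinj : Function.Injective (Sum.map (Fin.castLE hkl)
      (Prod.map (id : Fin p ⊕ Fin m → _) (Fin.castLE hkl))) :=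
    (Fin.castLE_injective hkl).sumMap (Function.injective_id.prodMap (Fin.castLE_injective hkl))
  convert hr.comp _ hinj using 1
  funext r j
  exact congrFun (h.eq_castLE hkl hτ h' (sample_mem_Icc hτ j)) r

/-! ### The search for the index -/

theorem indexLoop_eq_of_first {rankLost : ℕ → Prop} {kmax k l : ℕ} (hkl : k < l) (hl : l ≤ kmax)
    (hnot : ∀ j, k < j → j < l → ¬ rankLost j) (hlost : rankLost l) :
    indexLoop rankLost kmax k = l := by
  induction hn : l - k generalizing k with
  | zero => omega
  | succ n ih =>
    rw [indexLoop, if_pos (by omega)]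
    by_cases hk : k + 1 = l
    · rw [if_pos (hk ▸ hlost), hk]
    · rw [if_neg (hnot _ (by omega) (by omega))]
      exact ih (by omega) (fun j hj => hnot j (by omega)) (by omega)

theorem theorem5 {n m p : ℕ} (hp : 0 < p)
    (A : Matrix (Fin n) (Fin n) ℝ) (B : Matrix (Fin n) (Fin m) ℝ) (C : Matrix (Fin p) (Fin n) ℝ)
    (hAB : IsControllablePair A B) (hCA : IsObservablePair C A)
    (hC : C.rank = p) (huniform : ∀ i : Fin p, outputObsIndex C A i = obsIndex C A)
    (τ : ℝ) (hτ : 0 < τ)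
    (u : ℝ → Fin m → ℝ) (x : ℝ → Fin n → ℝ) (y : ℝ → Fin p → ℝ)
    (hdata : IsPlantDataset A B C τ u x y)
    (νmax : ℕ) (hνmax : obsIndex C A < νmax)
    (lam gam : ℕ → ℝ) (hlam_pos : ∀ i ∈ Set.Icc 1 νmax, 0 < lam i)
    (hlam_mono : StrictMonoOn lam (Set.Icc 1 νmax)) (hgam : ∀ i ∈ Set.Icc 1 νmax, gam i ≠ 0)
    (N : ℕ) (hN : 1 ≤ N)
    (chi : (k : ℕ) → ℝ → Fin k → ℝ) (zeta : (k : ℕ) → ℝ → (Fin p ⊕ Fin m) × Fin k → ℝ)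
    (hsim : ∀ k ∈ Set.Icc 1 νmax, IsFilterSimulation lam gam τ u y k (chi k) (zeta k)) :
    (∀ νhat : ℕ, obsIndex C A + 1 ≤ νhat → νhat ≤ νmax →
      (sampledBatch τ N (chi νhat) (zeta νhat)).rank < νhat * (p + m + 1)) ∧
    ((sampledBatch τ N (chi (obsIndex C A)) (zeta (obsIndex C A))).rank =
        obsIndex C A * (p + m + 1) →
      indexEstimate
        (fun k => (sampledBatch τ N (chi k) (zeta k)).rank < k * (p + m + 1)) νmax =
          obsIndex C A) := by
  have hlost : ∀ νhat : ℕ, obsIndex C A + 1 ≤ νhat → νhat ≤ νmax →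
      (sampledBatch τ N (chi νhat) (zeta νhat)).rank < νhat * (p + m + 1) := by
    intro k hk hkmax
    have hsub : Set.Icc 1 k ⊆ Set.Icc 1 νmax := Set.Icc_subset_Icc le_rfl hkmax
    obtain ⟨w, hw, h0⟩ := (hsim k ⟨by omega, hkmax⟩).exists_annihilator hτ.le hdata
      (hlam_mono.injOn.mono hsub) (fun i hi => hgam i (hsub hi)) hp hk
    exact rank_sampledBatch_lt_of_annihilator hτ.le hw h0
  refine ⟨hlost, fun hfull => ?_⟩
  -- The loop first tests order `2`, so it can stop at `ν + 1` only if `ν ≥ 1`.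
  have hν := one_le_obsIndex hp hC A
  rw [indexEstimate, indexLoop_eq_of_first (l := obsIndex C A + 1) (by omega) hνmax
    (fun j hj hjν => ?_) (hlost _ le_rfl hνmax), Nat.add_sub_cancel]
  exact ((hsim j ⟨by omega, by omega⟩).rank_sampledBatch_eq_of_le (Nat.lt_succ_iff.1 hjν) hτ.le
    (hsim _ ⟨hν, hνmax.le⟩) hfull).not_lt
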